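/- Let $n,m\ge 1$ be integers and let $\Psi_1,\dots,\Psi_m:\mathbb{Z}^n\setminus\{\mathbf 0\}\to[0,\infty)$ be arbitrary functions. For functions $\Phi_1,\dots,\Phi_m:\mathbb{Z}^n\setminus\{\mathbf 0\}\to[0,\infty)$, let $\mathcal{C}_{n,m}(\Phi_1,\dots,\Phi_m)$ denote the set of $(\mathbf X^{(1)},\dots,\mathbf X^{(m)})\in([0,1]^n)^m$ for which $$|\mathbf q\cdot\mathbf X^{(j)}+p_j|<\Phi_j(\mathbf q)\qquad(j=1,\dots,m)$$ holds for infinitely many pairs $(\mathbf q,\mathbf p)$ with $\mathbf q=(q_1,\dots,q_n)\in\mathbb{Z}^n\setminus\{\mathbf 0\}$, $\mathbf p=(p_1,\dots,p_m)\in\mathbb{Z}^m$ and $\gcd(q_1,\dots,q_n,p_1,\dots,p_m)=1$. Then there is $c\in\{0,1\}$, depending only on $n$, $m$ and $\Psi_1,\dots,\Psi_m$, such that for all real numbers $k_1,\dots,k_m>0$ the $nm$-dimensional Lebesgue measure of $\mathcal{C}_{n,m}(k_1\Psi_1,\dots,k_m\Psi_m)$ equals $c$. -/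

import Mathlib

open MeasureTheory
open scoped ENNReal

/-- The integer vectors `q` and `p` (possibly of different lengths) are coprime: the greatest
common divisor of all the components of `q` and of `p` taken together is `1`. -/
def GloballyCoprime {n m : ℕ} (q : Fin n → ℤ) (p : Fin m → ℤ) : Prop :=
  Int.gcd (Finset.univ.gcd q) (Finset.univ.gcd p) = 1

/-- The set of those `X = (X 0, …, X (m - 1))`, with every column `X j` in the unit cube `[0, 1]ⁿ`,
for which `|q · X j + p j| < Ψ j q` for all `j` holds for infinitely many pairs `(q, p)` of
a nonzero integer vector `q` of length `n` and an integer vector `p` of length `m`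
that are globally coprime. -/
def approxSetC {n m : ℕ} (Ψ : Fin m → {q : Fin n → ℤ // q ≠ 0} → ℝ) :
    Set (Fin m → Fin n → ℝ) :=
  {X | (∀ j i, X j i ∈ Set.Icc (0 : ℝ) 1) ∧
    {qp : {q : Fin n → ℤ // q ≠ 0} × (Fin m → ℤ) |
      GloballyCoprime qp.1.1 qp.2 ∧
      ∀ j, |(∑ i, (qp.1.1 i : ℝ) * X j i) + (qp.2 j : ℝ)| < Ψ j qp.1}.Infinite}

/-! ### Zero-one laws from density points -/

section ZeroOne

open Filter Topology Metric

/-! Drop the unit cube and work with `approxSetFull` on the whole space, where translations and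
homotheties act. Two facts suffice.

Scaling (`approxSetFull_mul_ae_eq`): constants change the set by a null set. By Fubini it suffices
to scale one column with the others frozen; each pair is then a strip around a hyperplane. If the
relative widths `Φ j q / ∑ |q i|` tend to zero along the admissible `q`, a Cassels-type lemma on
limsups of thickenings applies. Otherwise infinitely many widths are proportional to the size of
`q`. Gaps between integers coprime to `d` are `o(Q)` for `d ≤ Q`, so every point of the column is
then approximable, whatever the constant.

Zero-one law (`volume_approxSetFull`): for a prime `l`, split the `q` into `l ∤ q`, `l ∣ q` with `l²
∤ q`, and `l² ∣ q`. The first class and finitely many pieces of the second are preserved, up to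
scaling the widths, by maps `X ↦ l X + v`, so each gives a null or conull set. If one is conull, so
is the whole set. Otherwise only `l² ∣ q` matters, and that part is invariant under translations in
`l⁻¹ℤ`. With `l` arbitrarily large, density points settle the matter. -/

theorem measure_inter_closedBall_add_eq {V : Type*} [NormedAddCommGroup V] [MeasurableSpace V]
    [BorelSpace V] {μ : Measure V} [μ.IsAddHaarMeasure] {E : Set V} {v : V}
    (h : (fun z => z + v) ⁻¹' E =ᵐ[μ] E) (x : V) (r : ℝ) :
    μ (E ∩ closedBall (x + v) r) = μ (E ∩ closedBall x r) := by
  have h1 : (fun z => z + v) ⁻¹' (E ∩ closedBall (x + v) r) =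
      ((fun z => z + v) ⁻¹' E) ∩ closedBall x r := by
    ext z; simp
  rw [← measure_preimage_add_right μ v (E ∩ closedBall (x + v) r), h1]
  exact measure_congr (h.inter (ae_eq_refl _))

theorem measure_closedBall_add_eq {V : Type*} [NormedAddCommGroup V] [MeasurableSpace V]
    [BorelSpace V] {μ : Measure V} [μ.IsAddHaarMeasure] (x v : V) (r : ℝ) :
    μ (closedBall (x + v) r) = μ (closedBall x r) := by
  simpa using measure_inter_closedBall_add_eq (μ := μ) (E := Set.univ) (v := v) (by simp) x r

theorem exists_mem_of_ae_restrict {V : Type*} [MeasurableSpace V] {μ : Measure V} {E : Set V} (hE : μ E ≠ 0) {p : V → Prop}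
    (h : ∀ᵐ x ∂μ.restrict E, p x) : ∃ x, p x := by
  have : NeZero (μ.restrict E) := ⟨by simpa [Measure.restrict_eq_zero] using hE⟩
  exact h.exists

theorem preimage_smul_add_closedBall {V : Type*} [NormedAddCommGroup V] [NormedSpace ℝ V]
    {c : ℝ} (hc : 0 < c) (v x : V) (r : ℝ) :
    (fun x => c • x + v) ⁻¹' closedBall (c • x + v) (c * r) = closedBall x r := by
  ext z
  simp only [Set.mem_preimage, mem_closedBall, dist_add_right, dist_smul₀, Real.norm_eq_abs,
    abs_of_pos hc]
  exact mul_le_mul_iff_right₀ hc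

variable {V : Type*} [NormedAddCommGroup V] [NormedSpace ℝ V] [FiniteDimensional ℝ V]
  [MeasurableSpace V] [BorelSpace V] {μ : Measure V} [μ.IsAddHaarMeasure]

/-- A measurable set that is almost invariant under arbitrarily fine nets of translations is null
or conull. -/
theorem measure_eq_zero_or_compl_of_fine_translations {E : Set V} (hE : MeasurableSet E)
    (h : ∀ ε > 0, ∃ δ, 0 < δ ∧ δ < ε ∧
      ∀ x y : V, ∃ v, dist (x + v) y ≤ δ ∧ (fun z => z + v) ⁻¹' E =ᵐ[μ] E) :
    μ E = 0 ∨ μ Eᶜ = 0 := by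
  by_contra! hne
  choose δ hδ0 hδ1 hδ using fun k : ℕ => h (1 / ((k : ℝ) + 1)) (by positivity)
  have hδlim : Tendsto δ atTop (𝓝[>] 0) := by
    rw [tendsto_nhdsWithin_iff]
    exact ⟨squeeze_zero (fun k => (hδ0 k).le) (fun k => (hδ1 k).le)
      tendsto_one_div_add_atTop_nhds_zero_nat, Eventually.of_forall hδ0⟩
  obtain ⟨x, hx⟩ := exists_mem_of_ae_restrict hne.1
    (IsUnifLocDoublingMeasure.ae_tendsto_measure_inter_div μ E 1)
  obtain ⟨y, hy⟩ := exists_mem_of_ae_restrict hne.2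
    (IsUnifLocDoublingMeasure.ae_tendsto_measure_inter_div μ Eᶜ 1)
  choose v hv hvE using fun k => hδ k x y
  have h1 := hx (fun _ : ℕ => x) δ hδlim
    (Eventually.of_forall fun k => by simpa using (hδ0 k).le)
  -- These balls contain `y` without being centred there; the density theorem allows this.
  have h2 := hy (fun k => x + v k) δ hδlim
    (Eventually.of_forall fun k => by
      rw [mem_closedBall, dist_comm, one_mul]; exact hv k)
  -- By invariance `Eᶜ` has the same share of both balls, so the densities add up to 1, although
  -- each tends to 1.
  have h3 : ∀ k, μ (E ∩ closedBall x (δ k)) / μ (closedBall x (δ k)) +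
      μ (Eᶜ ∩ closedBall (x + v k) (δ k)) / μ (closedBall (x + v k) (δ k)) = 1 := by
    intro k
    rw [measure_inter_closedBall_add_eq (hvE k).compl, measure_closedBall_add_eq,
      ← ENNReal.add_div, Set.inter_comm E, Set.inter_comm Eᶜ, ← Set.sdiff_eq,
      measure_inter_add_sdiff _ hE]
    exact ENNReal.div_self (measure_closedBall_pos μ x (hδ0 k)).ne' measure_closedBall_lt_top.ne
  have h4 := h1.add h2
  simp only [h3] at h4
  have := tendsto_nhds_unique h4 tendsto_const_nhds
  norm_num at this

theorem measure_preimage_smul_add {c : ℝ} (hc : c ≠ 0) (v : V) (A : Set V) :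
    μ ((fun x => c • x + v) ⁻¹' A) =
      ENNReal.ofReal |(c ^ Module.finrank ℝ V)⁻¹| * μ A := by
  have : (fun x => c • x + v) ⁻¹' A = (fun x => c • x) ⁻¹' ((fun x => x + v) ⁻¹' A) := rfl
  rw [this, Measure.addHaar_preimage_smul μ hc, measure_preimage_add_right]

/-- A measurable set that is almost invariant under a relatively dense set of translations and is
mapped into itself by an expanding homothety is null or conull. -/
theorem measure_eq_zero_or_compl_of_homothety {E : Set V} (hE : MeasurableSet E)
    {c : ℝ} (hc : 1 < c) (v : V) (hg : E ≤ᵐ[μ] (fun x => c • x + v) ⁻¹' E) {R : ℝ} (hR : 0 < R)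
    (h : ∀ x y : V, ∃ w, dist (x + w) y ≤ R ∧ (fun z => z + w) ⁻¹' E =ᵐ[μ] E) :
    μ E = 0 ∨ μ Eᶜ = 0 := by
  have hc0 : 0 < c := zero_lt_one.trans hc
  rw [or_iff_not_imp_left]
  intro hne
  obtain ⟨x, hx⟩ := exists_mem_of_ae_restrict hne
    (IsUnifLocDoublingMeasure.ae_tendsto_measure_inter_div μ E 1)
  -- Points of `E` stay in `E`, so expanding a ball cannot increase the share of `Eᶜ`.
  have step : ∀ (y : V) (r : ℝ),
      μ (Eᶜ ∩ closedBall (c • y + v) (c * r)) / μ (closedBall (c • y + v) (c * r)) ≤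
        μ (Eᶜ ∩ closedBall y r) / μ (closedBall y r) := by
    intro y r
    have hpos : ENNReal.ofReal |(c ^ Module.finrank ℝ V)⁻¹| ≠ 0 := by
      simp only [ne_eq, ENNReal.ofReal_eq_zero, not_le]; positivity
    have h1 : μ (closedBall y r) = ENNReal.ofReal |(c ^ Module.finrank ℝ V)⁻¹| *
        μ (closedBall (c • y + v) (c * r)) := by
      rw [← measure_preimage_smul_add hc0.ne' v, preimage_smul_add_closedBall hc0]
    have h2 : ENNReal.ofReal |(c ^ Module.finrank ℝ V)⁻¹| *
        μ (Eᶜ ∩ closedBall (c • y + v) (c * r)) ≤ μ (Eᶜ ∩ closedBall y r) := by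
      rw [← measure_preimage_smul_add hc0.ne' v, Set.preimage_inter,
        preimage_smul_add_closedBall hc0]
      refine measure_mono_ae (EventuallyLE.inter ?_ (EventuallyLE.refl _ _))
      filter_upwards [hg] with z hz h1 h2
      exact h1 (hz h2)
    rw [h1, ← ENNReal.mul_div_mul_left _ _ hpos ENNReal.ofReal_ne_top]
    exact ENNReal.div_le_div_right h2 _
  have iter : ∀ (k : ℕ), ∃ y, ∀ r : ℝ,
      μ (Eᶜ ∩ closedBall y (c ^ k * r)) / μ (closedBall y (c ^ k * r)) ≤
        μ (Eᶜ ∩ closedBall x r) / μ (closedBall x r) := by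
    intro k
    induction k with
    | zero => exact ⟨x, fun r => by simp⟩
    | succ k ih =>
      obtain ⟨y, hy⟩ := ih
      refine ⟨c • y + v, fun r => ?_⟩
      rw [pow_succ', mul_assoc]
      exact (step y _).trans (hy r)
  -- After `k` expansions the radius is `R + 1`: enough to contain a translate of any given unit
  -- ball by an almost-invariant vector.
  have hδlim : Tendsto (fun k : ℕ => (c ^ k)⁻¹ * (R + 1)) atTop (𝓝[>] 0) := by
    rw [tendsto_nhdsWithin_iff]
    refine ⟨?_, Eventually.of_forall fun k => by simp only [Set.mem_Ioi]; positivity⟩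
    have := (tendsto_inv_atTop_zero.comp (tendsto_pow_atTop_atTop_of_one_lt hc)).mul_const (R + 1)
    simpa using this
  have h1 := hx (fun _ : ℕ => x) _ hδlim
    (Eventually.of_forall fun k => by
      simp only [mem_closedBall, dist_self, one_mul]; positivity)
  have h2 : Tendsto (fun k : ℕ => μ (Eᶜ ∩ closedBall x ((c ^ k)⁻¹ * (R + 1))) /
      μ (closedBall x ((c ^ k)⁻¹ * (R + 1)))) atTop (𝓝 0) := by
    have h3 : ∀ k : ℕ, μ (Eᶜ ∩ closedBall x ((c ^ k)⁻¹ * (R + 1))) /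
        μ (closedBall x ((c ^ k)⁻¹ * (R + 1))) = 1 -
        μ (E ∩ closedBall x ((c ^ k)⁻¹ * (R + 1))) /
        μ (closedBall x ((c ^ k)⁻¹ * (R + 1))) := by
      intro k
      have hp : 0 < (c ^ k)⁻¹ * (R + 1) := by positivity
      refine ENNReal.eq_sub_of_add_eq ?_ ?_
      · exact (ENNReal.div_lt_top ((measure_mono Set.inter_subset_right).trans_lt
          measure_closedBall_lt_top).ne (measure_closedBall_pos μ x hp).ne').ne
      · rw [← ENNReal.add_div, Set.inter_comm E, Set.inter_comm Eᶜ, ← Set.sdiff_eq, add_comm,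
          measure_inter_add_sdiff _ hE]
        exact ENNReal.div_self (measure_closedBall_pos μ x hp).ne' measure_closedBall_lt_top.ne
    simp only [h3]
    have := ENNReal.Tendsto.sub (tendsto_const_nhds (x := (1 : ℝ≥0∞))) h1 (by simp)
    simpa using this
  have key : ∀ y : V, μ (Eᶜ ∩ closedBall y 1) = 0 := by
    intro y
    have h3 : ∀ k : ℕ, μ (Eᶜ ∩ closedBall y 1) ≤ μ (closedBall (0 : V) (R + 1)) *
        (μ (Eᶜ ∩ closedBall x ((c ^ k)⁻¹ * (R + 1))) /
          μ (closedBall x ((c ^ k)⁻¹ * (R + 1)))) := by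
      intro k
      obtain ⟨z, hz⟩ := iter k
      obtain ⟨w, hw, hwE⟩ := h y z
      have hz' := hz ((c ^ k)⁻¹ * (R + 1))
      rw [← mul_assoc, mul_inv_cancel₀ (by positivity), one_mul] at hz'
      rw [← measure_inter_closedBall_add_eq hwE.compl]
      calc μ (Eᶜ ∩ closedBall (y + w) 1) ≤ μ (Eᶜ ∩ closedBall z (R + 1)) :=
            measure_mono (Set.inter_subset_inter_right _ (closedBall_subset_closedBall'
              (by linarith)))
        _ = μ (closedBall (0 : V) (R + 1)) *
            (μ (Eᶜ ∩ closedBall z (R + 1)) / μ (closedBall z (R + 1))) := by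
            have := measure_closedBall_add_eq (μ := μ) 0 z (R + 1)
            rw [zero_add] at this
            rw [← this, ENNReal.mul_div_cancel (measure_closedBall_pos μ z (by positivity)).ne'
              measure_closedBall_lt_top.ne]
        _ ≤ _ := by gcongr
    have h4 := ENNReal.Tendsto.const_mul h2 (a := μ (closedBall (0 : V) (R + 1)))
      (Or.inr measure_closedBall_lt_top.ne)
    rw [mul_zero] at h4
    exact le_antisymm (ge_of_tendsto' h4 h3) zero_le
  exact measure_null_of_locally_null _ fun y _ =>
    ⟨Eᶜ ∩ closedBall y 1, inter_mem_nhdsWithin _ (closedBall_mem_nhds y one_pos), key y⟩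

end ZeroOne

/-! ### Gaps between integers coprime to `d` -/

section Jacobsthal

/-- The maximum of a set of `k` positive integers is at least `k`. Applied to prime factors, it
gives `r! ≤ d`. -/
theorem Finset.card_factorial_le_prod (s : Finset ℕ) (hs : ∀ x ∈ s, 0 < x) :
    s.card.factorial ≤ ∏ x ∈ s, x := by
  induction s using Finset.induction_on_max with
  | empty => simp
  | insert a s ha ih =>
    have hna : a ∉ s := fun h => lt_irrefl _ (ha a h)
    rw [Finset.card_insert_of_notMem hna, Finset.prod_insert hna, Nat.factorial_succ]
    refine Nat.mul_le_mul ?_ (ih fun x hx => hs x (Finset.mem_insert_of_mem hx))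
    have : s ⊆ Finset.Ico 1 a := fun x hx =>
      Finset.mem_Ico.2 ⟨hs x (Finset.mem_insert_of_mem hx), ha x hx⟩
    have h1 := Finset.card_le_card this
    have h2 := hs a (Finset.mem_insert_self _ _)
    simp at h1; omega

/-- Among `(r + 1) * 4 ^ r` consecutive integers one is coprime to `d`, where `r` is the number of
prime factors of `d`. -/
theorem exists_isCoprime_of_primeFactors (d : ℕ) (hd : d ≠ 0) (a : ℤ) :
    ∃ b : ℤ, a ≤ b ∧ b ≤ a + (d.primeFactors.card + 1) * 4 ^ d.primeFactors.card ∧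
      IsCoprime b (d : ℤ) := by
  set r := d.primeFactors.card with hr
  -- Integers congruent to 1 modulo `P` avoid all primes up to `r`. A larger prime divides `a' + t *
  -- P` for at most one of the `r + 1` values of `t`, so some `t` escapes the `r` primes of `d`.
  obtain ⟨P, hPdef⟩ : ∃ P, P = primorial r := ⟨_, rfl⟩
  have hP0 : 0 < P := hPdef ▸ primorial_pos r
  have hP4 : P ≤ 4 ^ r := hPdef ▸ primorial_le_four_pow r
  obtain ⟨a', ha'1, ha'2, ha'3⟩ : ∃ a' : ℤ, a ≤ a' ∧ a' < a + P ∧ (P : ℤ) ∣ a' - 1 := by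
    have hP0' : (0 : ℤ) < P := by exact_mod_cast hP0
    refine ⟨a + (1 - a) % P, by have := Int.emod_nonneg (1 - a) hP0'.ne'; omega,
      by have := Int.emod_lt_of_pos (1 - a) hP0'; omega, ?_⟩
    have := Int.mul_ediv_add_emod (1 - a) P
    exact ⟨-((1 - a) / P), by linarith⟩
  have hex : ∃ t ∈ Finset.range (r + 1), ∀ p ∈ d.primeFactors, ¬ (p : ℤ) ∣ a' + t * P := by
    by_contra! hcon
    choose! f hf1 hf2 using hcon
    obtain ⟨s, hs, t, ht, hst, hfe⟩ := Finset.exists_ne_map_eq_of_card_lt_of_maps_to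
      (s := Finset.range (r + 1)) (t := d.primeFactors) (by simp [← hr]) (f := f) hf1
    have hpr := Nat.prime_of_mem_primeFactors (hf1 s hs)
    have hpri : Prime ((f s : ℕ) : ℤ) := Nat.prime_iff_prime_int.1 hpr
    have h1 := hf2 s hs
    have h2 := hf2 t ht
    rw [← hfe] at h2
    by_cases hle : f s ≤ r
    · have hdvd : f s ∣ P := by
        rw [hPdef]; exact hpr.dvd_primorial_iff.2 hle
      have h3 : ((f s : ℕ) : ℤ) ∣ P := by exact_mod_cast hdvd
      have h4 : ((f s : ℕ) : ℤ) ∣ 1 := by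
        have h5 := (dvd_add_left (h3.mul_left (s : ℤ))).1 h1
        have := dvd_sub h5 (h3.trans ha'3)
        simpa using this
      exact hpri.not_isUnit (isUnit_of_dvd_one h4)
    · have hndvd : ¬ ((f s : ℕ) : ℤ) ∣ P := by
        rw [Int.natCast_dvd_natCast, hPdef, hpr.dvd_primorial_iff]; exact hle
      have h3 : ((f s : ℕ) : ℤ) ∣ ((s : ℤ) - t) * P := by
        have := dvd_sub h1 h2
        ring_nf at this ⊢; exact this
      have h4 := (hpri.dvd_or_dvd h3).resolve_right hndvd
      simp only [Finset.mem_range] at hs ht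
      have h5 := Int.eq_zero_of_abs_lt_dvd h4 (by rw [abs_lt]; omega)
      omega
  obtain ⟨t, ht, htp⟩ := hex
  simp only [Finset.mem_range] at ht
  refine ⟨a' + t * P, ?_, ?_, ?_⟩
  · have : (0 : ℤ) ≤ t * P := by positivity
    linarith
  · have h1 : (t : ℤ) * P ≤ r * 4 ^ r := by
      have : t * P ≤ r * 4 ^ r := Nat.mul_le_mul (by omega) hP4
      exact_mod_cast this
    have h2 : (P : ℤ) ≤ 4 ^ r := by exact_mod_cast hP4
    linarith
  · rw [Int.isCoprime_iff_gcd_eq_one]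
    by_contra hne
    obtain ⟨p, hp, hpd⟩ := Nat.exists_prime_and_dvd hne
    have h1 : (p : ℤ) ∣ _ := (Int.natCast_dvd_natCast.2 hpd)
    refine htp p (Nat.mem_primeFactors.2 ⟨hp, ?_, hd⟩) (h1.trans (Int.gcd_dvd_left ..))
    exact Int.natCast_dvd_natCast.1 (h1.trans (Int.gcd_dvd_right ..))

/-- Gaps between integers coprime to `d` are `o(Q)`, uniformly for `0 < d ≤ Q`. -/
theorem exists_isCoprime_Icc (ε : ℝ) (hε : 0 < ε) : ∃ Q₀ : ℝ, ∀ Q ≥ Q₀, ∀ d : ℕ, d ≠ 0 →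
    (d : ℝ) ≤ Q → ∀ a : ℤ, ∃ b : ℤ, a ≤ b ∧ (b : ℝ) ≤ a + ε * Q ∧ IsCoprime b (d : ℤ) := by
  have hlim : Filter.Tendsto (fun r : ℕ => (4 : ℝ) * ((8 : ℝ) ^ r / r.factorial)) Filter.atTop
      (nhds 0) := by
    simpa using (FloorSemiring.tendsto_pow_div_factorial_atTop (8 : ℝ)).const_mul 4
  -- For `r ≥ R` the gap is at most `8 ^ r ≤ ε * r! ≤ ε * d`; for `r < R` it is bounded, and `Q₀`
  -- absorbs it.
  obtain ⟨R, hR⟩ := Filter.eventually_atTop.1 (hlim.eventually (gt_mem_nhds hε))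
  refine ⟨((R : ℝ) + 1) * 4 ^ R / ε, fun Q hQ d hd hdQ a => ?_⟩
  obtain ⟨b, hb1, hb2, hb3⟩ := exists_isCoprime_of_primeFactors d hd a
  refine ⟨b, hb1, ?_, hb3⟩
  set r := d.primeFactors.card
  have hb2' : (b : ℝ) ≤ a + (r + 1) * 4 ^ r := by exact_mod_cast hb2
  refine hb2'.trans (add_le_add_right ?_ _)
  rcases le_or_gt R r with h | h
  · have h1 := hR r h
    have hfac : (0 : ℝ) < r.factorial := by positivity
    have h2 : (r.factorial : ℝ) ≤ d := by
      have h3 := Finset.card_factorial_le_prod d.primeFactors fun p hp =>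
        (Nat.prime_of_mem_primeFactors hp).pos
      exact_mod_cast h3.trans (Nat.le_of_dvd (Nat.pos_of_ne_zero hd) (Nat.prod_primeFactors_dvd d))
    have h3 : 4 * (8 : ℝ) ^ r < ε * r.factorial := by
      rw [← mul_div_assoc, div_lt_iff₀ hfac] at h1; exact h1
    have h4 : ((r : ℝ) + 1) ≤ 2 ^ r := by exact_mod_cast Nat.lt_two_pow_self (n := r)
    have h5 : ((r : ℝ) + 1) * 4 ^ r ≤ 8 ^ r := by
      calc ((r : ℝ) + 1) * 4 ^ r ≤ 2 ^ r * 4 ^ r := by gcongr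
        _ = 8 ^ r := by rw [← mul_pow]; norm_num
    have h6 : ε * r.factorial ≤ ε * Q := by gcongr; exact h2.trans hdQ
    have : (0 : ℝ) < 8 ^ r := by positivity
    linarith
  · have h1 : ((r : ℝ) + 1) * 4 ^ r ≤ (R + 1) * 4 ^ R := by
      gcongr
      norm_num
    rw [ge_iff_le, div_le_iff₀ hε] at hQ
    linarith

end Jacobsthal

/-! ### Invariance under scaling of the widths -/

section Scaling

open Filter Topology Metric

variable {n m : ℕ}

theorem globallyCoprime_iff {q : Fin n → ℤ} {p : Fin m → ℤ} :
    GloballyCoprime q p ↔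
      ∀ l : ℕ, l.Prime → (∀ i, (l : ℤ) ∣ q i) → ¬ ∀ j, (l : ℤ) ∣ p j := by
  have hdvd : ∀ l : ℕ, l ∣ Int.gcd (Finset.univ.gcd q) (Finset.univ.gcd p) ↔
      (∀ i, (l : ℤ) ∣ q i) ∧ ∀ j, (l : ℤ) ∣ p j := fun l => by
    rw [← Int.natCast_dvd_natCast, Int.dvd_coe_gcd_iff, Finset.dvd_gcd_iff, Finset.dvd_gcd_iff]
    simp
  rw [GloballyCoprime, Nat.eq_one_iff_not_exists_prime_dvd]
  exact forall₂_congr fun l _ => by rw [hdvd, not_and]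

/-- The coprime pairs `(q, p)` satisfying the approximation conditions at `X`. -/
def approxPairs (Φ : Fin m → {q : Fin n → ℤ // q ≠ 0} → ℝ) (X : Fin m → Fin n → ℝ) :
    Set ({q : Fin n → ℤ // q ≠ 0} × (Fin m → ℤ)) :=
  {qp | GloballyCoprime qp.1.1 qp.2 ∧
    ∀ j, |(∑ i, (qp.1.1 i : ℝ) * X j i) + (qp.2 j : ℝ)| < Φ j qp.1}

/-- The points of the whole space that are approximable infinitely often. -/
def approxSetFull (Φ : Fin m → {q : Fin n → ℤ // q ≠ 0} → ℝ) : Set (Fin m → Fin n → ℝ) :=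
  {X | (approxPairs Φ X).Infinite}

theorem measurableSet_setOf_infinite {α ι : Type*} [MeasurableSpace α] [Countable ι]
    {p : ι → α → Prop} (h : ∀ t, MeasurableSet {x | p t x}) :
    MeasurableSet {x | {t | p t x}.Infinite} := by
  have : {x | {t | p t x}.Infinite} = ⋂ F : Finset ι, ⋃ t : {t // t ∉ F}, {x | p t x} := by
    ext x
    simp only [Set.mem_ofPred_eq, Set.mem_iInter, Set.mem_iUnion, Subtype.exists, exists_prop]
    refine ⟨fun hx F => ?_, fun hx hfin => ?_⟩
    · obtain ⟨t, h1, h2⟩ := hx.exists_notMem_finset F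
      exact ⟨t, h2, h1⟩
    · obtain ⟨t, h1, h2⟩ := hx hfin.toFinset
      exact h1 (hfin.mem_toFinset.2 h2)
  rw [this]
  exact .iInter fun F => .iUnion fun t => h t

theorem measurableSet_approxSetFull (Φ : Fin m → {q : Fin n → ℤ // q ≠ 0} → ℝ) :
    MeasurableSet (approxSetFull Φ) := by
  refine measurableSet_setOf_infinite fun t => ?_
  refine (MeasurableSet.const _).inter ?_
  have : {X : Fin m → Fin n → ℝ |
      ∀ j, |(∑ i, (t.1.1 i : ℝ) * X j i) + (t.2 j : ℝ)| < Φ j t.1} =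
      ⋂ j, {X | |(∑ i, (t.1.1 i : ℝ) * X j i) + (t.2 j : ℝ)| < Φ j t.1} := by
    ext X; simp
  change MeasurableSet {X : Fin m → Fin n → ℝ |
      ∀ j, |(∑ i, (t.1.1 i : ℝ) * X j i) + (t.2 j : ℝ)| < Φ j t.1}
  rw [this]
  refine .iInter fun j => measurableSet_lt ?_ measurable_const
  fun_prop

theorem abs_sum_mul_le (q y : Fin n → ℝ) : |∑ i, q i * y i| ≤ (∑ i, |q i|) * ‖y‖ := by
  rw [Finset.sum_mul]
  refine (Finset.abs_sum_le_sum_abs _ _).trans (Finset.sum_le_sum fun i _ => ?_)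
  rw [abs_mul]
  gcongr
  exact norm_le_pi_norm y i

theorem sum_abs_pos {q : Fin n → ℝ} (hq : q ≠ 0) : 0 < ∑ i, |q i| := by
  obtain ⟨i, hi⟩ := Function.ne_iff.1 hq
  exact Finset.sum_pos' (fun _ _ => abs_nonneg _) ⟨i, Finset.mem_univ _, abs_pos.2 hi⟩

theorem thickening_hyperplane {q : Fin n → ℝ} (hq : q ≠ 0) (b w : ℝ) :
    thickening (w / ∑ i, |q i|) {y : Fin n → ℝ | ∑ i, q i * y i + b = 0} =
      {y | |∑ i, q i * y i + b| < w} := by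
  have hpos := sum_abs_pos hq
  ext y
  rw [mem_thickening_iff]
  constructor
  · rintro ⟨z, hz, hd⟩
    rw [Set.mem_ofPred_eq] at hz ⊢
    have h1 : ∑ i, q i * y i + b = ∑ i, q i * (y - z) i := by
      simp only [Pi.sub_apply, mul_sub, Finset.sum_sub_distrib]
      linarith
    rw [h1]
    refine (abs_sum_mul_le q (y - z)).trans_lt ?_
    rwa [lt_div_iff₀ hpos, mul_comm, dist_eq_norm] at hd
  · intro hy
    rw [Set.mem_ofPred_eq] at hy
    set t := ∑ i, q i * y i + b with ht
    -- A nearest point in the sup norm: all coordinates with `q i ≠ 0` move equally far, and the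
    -- dual ℓ¹ norm of `q` appears.
    refine ⟨fun i => y i - t / (∑ i, |q i|) * SignType.sign (q i), ?_, ?_⟩
    · simp only [Set.mem_ofPred_eq, mul_sub, Finset.sum_sub_distrib]
      have : ∀ i, q i * (t / (∑ i, |q i|) * (SignType.sign (q i) : ℝ)) =
          t / (∑ i, |q i|) * |q i| := fun i => by
        rw [← self_mul_sign (q i)]; ring
      simp only [this]
      rw [← Finset.mul_sum, div_mul_cancel₀ _ hpos.ne']
      rw [ht]; ring
    · have h0 : |t| / (∑ i, |q i|) < w / ∑ i, |q i| := by gcongr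
      refine lt_of_le_of_lt ((dist_pi_le_iff (by positivity)).2 fun i => ?_) h0
      rw [Real.dist_eq, sub_sub_cancel, abs_mul, abs_div, abs_of_pos hpos]
      refine mul_le_of_le_one_right (by positivity) ?_
      rcases lt_trichotomy (q i) 0 with h | h | h <;> simp [h]

/-- Multiplying the widths of a sequence of neighbourhoods of hyperplanes by a constant changes
their upper limit by a null set, as long as the widths tend to zero. -/
theorem ae_infinite_strips_iff {ι : Type*} [Countable ι] (q : ι → Fin n → ℝ) (hq : ∀ t, q t ≠ 0)
    (b w : ι → ℝ) (hw : ∀ t, 0 ≤ w t) (S : Set ι)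
    (hS : ∀ ε > 0, {t | t ∈ S ∧ ε * ∑ i, |q t i| ≤ w t}.Finite) {k : ℝ} (hk : 0 < k) :
    ∀ᵐ y : Fin n → ℝ, {t | t ∈ S ∧ |∑ i, q t i * y i + b t| < k * w t}.Infinite ↔
      {t | t ∈ S ∧ |∑ i, q t i * y i + b t| < w t}.Infinite := by
  classical
  rcases finite_or_infinite ι with hι | hι
  · exact .of_forall fun y => iff_of_false (fun h => h (Set.toFinite _)) (fun h => h (Set.toFinite _))
  obtain ⟨e⟩ : Nonempty (ℕ ≃ ι) := by
    obtain ⟨_⟩ := nonempty_denumerable ι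
    exact ⟨(Denumerable.eqv ι).symm⟩
  -- The limsup ignores indices outside `S`; the value 0 there makes the whole sequence tend to
  -- zero.
  set r : ℕ → ℝ := fun a => if e a ∈ S then w (e a) / ∑ i, |q (e a) i| else 0 with hr
  have hr0 : ∀ a, 0 ≤ r a := fun a => by
    simp only [hr]; split_ifs
    · exact div_nonneg (hw _) (sum_abs_pos (hq _)).le
    · exact le_rfl
  have hlim : Tendsto r atTop (𝓝 0) := by
    rw [Metric.tendsto_atTop']
    intro ε hε
    have hfin := (hS ε hε).preimage (e.injective.injOn)
    obtain ⟨N, hN⟩ := hfin.bddAbove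
    refine ⟨N, fun a ha => ?_⟩
    rw [Real.dist_0_eq_abs, abs_of_nonneg (hr0 a)]
    by_contra! hcon
    refine absurd (hN (a := a) ?_) (not_le.2 ha)
    by_cases hmem : e a ∈ S
    · simp only [hr, if_pos hmem] at hcon
      exact ⟨hmem, (le_div_iff₀ (sum_abs_pos (hq _))).1 hcon⟩
    · simp only [hr, if_neg hmem] at hcon
      exact absurd hcon (not_le.2 hε)
  have key := blimsup_thickening_mul_ae_eq (volume : Measure (Fin n → ℝ)) (fun a => e a ∈ S)
    (fun a => {y : Fin n → ℝ | ∑ i, q (e a) i * y i + b (e a) = 0}) hk r hlim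
  have hmem : ∀ c : ℝ, ∀ y : Fin n → ℝ,
      y ∈ blimsup (fun a => thickening (c * r a)
        {y : Fin n → ℝ | ∑ i, q (e a) i * y i + b (e a) = 0}) atTop (fun a => e a ∈ S) ↔
      {t | t ∈ S ∧ |∑ i, q t i * y i + b t| < c * w t}.Infinite := by
    intro c y
    rw [← Nat.cofinite_eq_atTop, cofinite.blimsup_set_eq, Set.mem_ofPred_eq,
      ← Set.infinite_image_iff e.injective.injOn]
    refine iff_of_eq (congrArg Set.Infinite ?_)
    ext t
    obtain ⟨a, rfl⟩ := e.surjective t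
    rw [e.injective.mem_set_image]
    refine and_congr_right fun ha => ?_
    simp only [hr, if_pos ha]
    rw [← mul_div_assoc, thickening_hyperplane (hq _)]
    rfl
  filter_upwards [key.mem_iff] with y hy
  rw [← hmem k y, hy]
  have := hmem 1 y
  simp only [one_mul] at this
  exact this


/-- Fubini, integrating column `j` first; it reduces scaling to one column. -/
theorem ae_of_ae_update {p : (Fin m → Fin n → ℝ) → Prop} (hp : MeasurableSet {X | p X}) (j : Fin m)
    (h : ∀ X, ∀ᵐ y : Fin n → ℝ, p (Function.update X j y)) : ∀ᵐ X, p X := by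
  have hm : Measurable ({X | p X}ᶜ.indicator (fun _ => (1 : ℝ≥0∞))) :=
    measurable_const.indicator hp.compl
  have hz : (fun X : Fin m → Fin n → ℝ => ∫⁻ y, {X | p X}ᶜ.indicator (fun _ => (1 : ℝ≥0∞))
      (Function.update X j y)) = 0 := by
    funext X
    rw [Pi.zero_apply]
    refine (lintegral_congr_ae ?_).trans lintegral_zero
    filter_upwards [h X] with y hy
    simp [hy]
  rw [ae_iff]
  change volume {X | p X}ᶜ = 0
  rw [← lintegral_indicator_one hp.compl]
  change ∫⁻ X, {X | p X}ᶜ.indicator (fun _ => (1 : ℝ≥0∞)) X ∂Measure.pi _ = 0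
  rw [lintegral_eq_lmarginal_univ (0 : Fin m → Fin n → ℝ), lmarginal_erase' _ hm
    (Finset.mem_univ j), hz]
  simp [lmarginal]

theorem intCast_ne_zero_of_ne_zero {q : Fin n → ℤ} (hq : q ≠ 0) : (fun i => (q i : ℝ)) ≠ 0 := by
  obtain ⟨i, hi⟩ := Function.ne_iff.1 hq
  exact Function.ne_iff.2 ⟨i, by simpa using hi⟩

/-- If the admissible width is proportional to the size of `q`, then some `p j` is close enough to
`- q · y` and keeps the pair coprime. -/
theorem exists_globallyCoprime_update (ε : ℝ) (hε : 0 < ε) : ∃ Q₀ : ℝ,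
    ∀ (q : Fin n → ℤ) (p : Fin m → ℤ) (j : Fin m), q ≠ 0 → Q₀ ≤ ∑ i, |(q i : ℝ)| →
      GloballyCoprime q p → ∀ y : Fin n → ℝ, ∃ b : ℤ,
        GloballyCoprime q (Function.update p j b) ∧
        |∑ i, (q i : ℝ) * y i + b| < ε * ∑ i, |(q i : ℝ)| := by
  obtain ⟨Q₁, hQ₁⟩ := exists_isCoprime_Icc (ε / 2) (half_pos hε)
  refine ⟨max Q₁ (2 / ε), fun q p j hq hQ hqp y => ?_⟩
  set Q := ∑ i, |(q i : ℝ)| with hQdef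
  obtain ⟨i₀, hi₀⟩ := Function.ne_iff.1 hq
  rw [Pi.zero_apply] at hi₀
  -- Coprimality to `d` is all that `b` needs, and `d ≤ Q` since `d` divides a nonzero `q i₀`. Half
  -- of `ε * Q` pays for the gap, half for rounding up.
  set d := Int.gcd (Finset.univ.gcd q) ((Finset.univ.erase j).gcd p) with hd
  have hdq : ∀ i, (d : ℤ) ∣ q i := fun i =>
    (Int.gcd_dvd_left ..).trans (Finset.gcd_dvd (Finset.mem_univ i))
  have hd0 : d ≠ 0 := fun h => hi₀ (by have := hdq i₀; rw [h] at this; simpa using this)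
  have hdQ : (d : ℝ) ≤ Q := by
    have h1 : (d : ℤ) ≤ |q i₀| := Int.le_of_dvd (abs_pos.2 hi₀) ((dvd_abs _ _).2 (hdq i₀))
    have h2 : (d : ℝ) ≤ |(q i₀ : ℝ)| := by exact_mod_cast h1
    exact h2.trans (Finset.single_le_sum (f := fun i => |(q i : ℝ)|)
      (fun _ _ => abs_nonneg _) (Finset.mem_univ i₀))
  obtain ⟨b, hb1, hb2, hb3⟩ := hQ₁ Q ((le_max_left _ _).trans hQ) d hd0 hdQ
    ⌈-∑ i, (q i : ℝ) * y i⌉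
  refine ⟨b, ?_, ?_⟩
  · rw [globallyCoprime_iff] at hqp ⊢
    intro l hl hlq hlp
    have hlb : (l : ℤ) ∣ b := by simpa using hlp j
    have hld : (l : ℤ) ∣ d := by
      refine Int.dvd_coe_gcd (Finset.dvd_gcd fun i _ => hlq i) (Finset.dvd_gcd fun i hi => ?_)
      simpa [Finset.ne_of_mem_erase hi] using hlp i
    exact (Nat.prime_iff_prime_int.1 hl).not_isUnit (hb3.isUnit_of_dvd' hlb hld)
  · have h1 := Int.le_ceil (-∑ i, (q i : ℝ) * y i)
    have h2 := Int.ceil_lt_add_one (-∑ i, (q i : ℝ) * y i)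
    have h3 : ((⌈-∑ i, (q i : ℝ) * y i⌉ : ℤ) : ℝ) ≤ b := by exact_mod_cast hb1
    have h4 : 2 ≤ ε * Q := by
      have := (le_max_right _ _).trans hQ
      rwa [div_le_iff₀ hε, mul_comm] at this
    rw [abs_lt]
    constructor <;> linarith

theorem finite_setOf_sum_abs_le (R : ℝ) :
    {q : {q : Fin n → ℤ // q ≠ 0} | ∑ i, |(q.1 i : ℝ)| ≤ R}.Finite := by
  refine Set.Finite.of_finite_image (f := Subtype.val) ?_ Subtype.val_injective.injOn
  refine (Set.finite_Icc (fun _ : Fin n => -⌈R⌉) (fun _ => ⌈R⌉)).subset ?_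
  rintro _ ⟨q, hq, rfl⟩
  have h : ∀ i, |q.1 i| ≤ ⌈R⌉ := fun i => by
    have h1 : |(q.1 i : ℝ)| ≤ R := (Finset.single_le_sum (f := fun i => |(q.1 i : ℝ)|)
      (fun _ _ => abs_nonneg _) (Finset.mem_univ i)).trans hq
    have h2 : ((|q.1 i| : ℤ) : ℝ) ≤ ⌈R⌉ := by push_cast; exact h1.trans (Int.le_ceil R)
    exact_mod_cast h2
  exact ⟨fun i => (abs_le.1 (h i)).1, fun i => (abs_le.1 (h i)).2⟩

theorem finite_setOf_abs_le (c r : Fin m → ℝ) :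
    {p : Fin m → ℤ | ∀ j, |c j + p j| ≤ r j}.Finite := by
  refine (Set.finite_Icc (fun j => ⌊-c j - r j⌋) (fun j => ⌈-c j + r j⌉)).subset ?_
  intro p hp
  refine ⟨fun j => ?_, fun j => ?_⟩
  · have := (abs_le.1 (hp j)).1
    have h2 := Int.floor_le (-c j - r j)
    exact_mod_cast (show ((⌊-c j - r j⌋ : ℤ) : ℝ) ≤ p j by linarith)
  · have := (abs_le.1 (hp j)).2
    have h2 := Int.le_ceil (-c j + r j)
    exact_mod_cast (show (p j : ℝ) ≤ ((⌈-c j + r j⌉ : ℤ) : ℝ) by linarith)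

/-- The coprime pairs satisfying the approximation conditions at `X` in all columns but `j`. -/
def approxPairsExcept (Φ : Fin m → {q : Fin n → ℤ // q ≠ 0} → ℝ) (j : Fin m)
    (X : Fin m → Fin n → ℝ) : Set ({q : Fin n → ℤ // q ≠ 0} × (Fin m → ℤ)) :=
  {qp | GloballyCoprime qp.1.1 qp.2 ∧
    ∀ l ≠ j, |(∑ i, (qp.1.1 i : ℝ) * X l i) + (qp.2 l : ℝ)| < Φ l qp.1}

theorem approxPairs_update (Φ : Fin m → {q : Fin n → ℤ // q ≠ 0} → ℝ) (j : Fin m)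
    (φ : {q : Fin n → ℤ // q ≠ 0} → ℝ) (X : Fin m → Fin n → ℝ) (y : Fin n → ℝ) :
    approxPairs (Function.update Φ j φ) (Function.update X j y) =
      {qp | qp ∈ approxPairsExcept Φ j X ∧
        |∑ i, (qp.1.1 i : ℝ) * y i + (qp.2 j : ℝ)| < φ qp.1} := by
  ext qp
  simp only [approxPairs, approxPairsExcept, Set.mem_ofPred_eq, and_assoc]
  refine and_congr_right fun _ => ⟨fun h => ⟨fun l hl => ?_, ?_⟩, fun h l => ?_⟩
  · simpa [hl] using h l
  · simpa using h j
  · by_cases hl : l = j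
    · subst hl; simpa using h.2
    · simpa [hl] using h.1 l hl

/-- If the width in column `j` is proportional to the size of `q` for infinitely many admissible
`q`, then every choice of column `j` is approximable infinitely often. -/
theorem infinite_of_proportional_width (Φ : Fin m → {q : Fin n → ℤ // q ≠ 0} → ℝ) (j : Fin m)
    (X : Fin m → Fin n → ℝ) {ε : ℝ} (hε : 0 < ε)
    (h : {q : {q : Fin n → ℤ // q ≠ 0} | ε * ∑ i, |(q.1 i : ℝ)| ≤ Φ j q ∧
      ∃ p, (q, p) ∈ approxPairsExcept Φ j X}.Infinite) {k : ℝ} (hk : 0 < k) (y : Fin n → ℝ) :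
    {qp | qp ∈ approxPairsExcept Φ j X ∧
        |∑ i, (qp.1.1 i : ℝ) * y i + (qp.2 j : ℝ)| < k * Φ j qp.1}.Infinite := by
  obtain ⟨Q₀, hQ₀⟩ := exists_globallyCoprime_update (n := n) (m := m) (k * ε) (by positivity)
  refine Set.Infinite.of_image Prod.fst ((h.sdiff (finite_setOf_sum_abs_le Q₀)).mono ?_)
  rintro q ⟨⟨h1, p, hp⟩, h2⟩
  rw [Set.mem_ofPred_eq, not_le] at h2
  obtain ⟨b, hb1, hb2⟩ := hQ₀ q.1 p j q.2 h2.le hp.1 y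
  refine ⟨(q, Function.update p j b), ⟨⟨hb1, fun l hl => ?_⟩, ?_⟩, rfl⟩
  · simpa [hl] using hp.2 l hl
  · simp only [Function.update_self]
    refine hb2.trans_le ?_
    rw [mul_assoc]
    gcongr

theorem ae_infinite_approxPairsExcept_iff (Φ : Fin m → {q : Fin n → ℤ // q ≠ 0} → ℝ)
    (hΦ : ∀ j q, 0 ≤ Φ j q) (j : Fin m) (X : Fin m → Fin n → ℝ) {k : ℝ} (hk : 0 < k) :
    ∀ᵐ y : Fin n → ℝ, {qp | qp ∈ approxPairsExcept Φ j X ∧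
        |∑ i, (qp.1.1 i : ℝ) * y i + (qp.2 j : ℝ)| < k * Φ j qp.1}.Infinite ↔
      {qp | qp ∈ approxPairsExcept Φ j X ∧
        |∑ i, (qp.1.1 i : ℝ) * y i + (qp.2 j : ℝ)| < Φ j qp.1}.Infinite := by
  by_cases hbig : ∃ ε > 0, {q : {q : Fin n → ℤ // q ≠ 0} | ε * ∑ i, |(q.1 i : ℝ)| ≤ Φ j q ∧
      ∃ p, (q, p) ∈ approxPairsExcept Φ j X}.Infinite
  · obtain ⟨ε, hε, h⟩ := hbig
    refine .of_forall fun y => iff_of_true (infinite_of_proportional_width Φ j X hε h hk y) ?_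
    simpa using infinite_of_proportional_width Φ j X hε h one_pos y
  · push Not at hbig
    set K := max 1 k with hK
    -- One `q` comes with infinitely many `p j`, all of the same width, so widths tend to zero only
    -- after truncation. `S R` keeps every strip, for either constant, that meets the ball of radius
    -- `R`.
    set S : ℕ → Set ({q : Fin n → ℤ // q ≠ 0} × (Fin m → ℤ)) := fun R =>
      {qp | qp ∈ approxPairsExcept Φ j X ∧
        |(qp.2 j : ℝ)| ≤ (∑ i, |(qp.1.1 i : ℝ)|) * R + K * Φ j qp.1} with hS
    have hall : ∀ᵐ y : Fin n → ℝ, ∀ R : ℕ,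
        {qp | qp ∈ S R ∧
          |∑ i, (qp.1.1 i : ℝ) * y i + (qp.2 j : ℝ)| < k * Φ j qp.1}.Infinite ↔
        {qp | qp ∈ S R ∧
          |∑ i, (qp.1.1 i : ℝ) * y i + (qp.2 j : ℝ)| < Φ j qp.1}.Infinite := by
      rw [ae_all_iff]
      intro R
      refine ae_infinite_strips_iff (fun qp : {q : Fin n → ℤ // q ≠ 0} × (Fin m → ℤ) =>
        fun i => (qp.1.1 i : ℝ)) (fun qp => intCast_ne_zero_of_ne_zero qp.1.2)
        (fun qp => (qp.2 j : ℝ)) (fun qp => Φ j qp.1) (fun qp => hΦ j qp.1) (S R) ?_ hk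
      intro ε hε
      have hfin := hbig ε hε
      refine Set.Finite.subset (hfin.biUnion fun q _ => (Set.finite_singleton q).prod
        (finite_setOf_abs_le (fun l => if l = j then 0 else ∑ i, (q.1 i : ℝ) * X l i)
          (fun l => if l = j then (∑ i, |(q.1 i : ℝ)|) * R + K * Φ j q else Φ l q))) ?_
      rintro ⟨q, p⟩ ⟨⟨h1, h2⟩, h3⟩
      simp only [Set.mem_iUnion]
      refine ⟨q, ⟨h3, p, h1⟩, rfl, fun l => ?_⟩
      by_cases hl : l = j
      · subst hl; simpa using h2
      · simpa [hl] using (h1.2 l hl).le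
    filter_upwards [hall] with y hy
    obtain ⟨R, hR⟩ := exists_nat_ge ‖y‖
    have hred : ∀ c ≤ K, {qp | qp ∈ approxPairsExcept Φ j X ∧
        |∑ i, (qp.1.1 i : ℝ) * y i + (qp.2 j : ℝ)| < c * Φ j qp.1} = {qp | qp ∈ S R ∧
          |∑ i, (qp.1.1 i : ℝ) * y i + (qp.2 j : ℝ)| < c * Φ j qp.1} := by
      intro c hc
      ext qp
      refine ⟨fun h => ⟨⟨h.1, ?_⟩, h.2⟩, fun h => ⟨h.1.1, h.2⟩⟩
      have h1 := abs_sum_mul_le (fun i => (qp.1.1 i : ℝ)) y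
      have h2 : (∑ i, |(qp.1.1 i : ℝ)|) * ‖y‖ ≤ (∑ i, |(qp.1.1 i : ℝ)|) * R := by gcongr
      have h3 : c * Φ j qp.1 ≤ K * Φ j qp.1 := mul_le_mul_of_nonneg_right hc (hΦ _ _)
      have h4 := abs_sub (∑ i, (qp.1.1 i : ℝ) * y i + (qp.2 j : ℝ)) (∑ i, (qp.1.1 i : ℝ) * y i)
      rw [add_sub_cancel_left] at h4
      linarith [h.2]
    have h1 := hred 1 (le_max_left _ _)
    simp only [one_mul] at h1
    rw [hred k (le_max_right _ _), h1]
    exact hy R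

theorem approxSetFull_update_ae_eq (Φ : Fin m → {q : Fin n → ℤ // q ≠ 0} → ℝ)
    (hΦ : ∀ j q, 0 ≤ Φ j q) (j : Fin m) {k : ℝ} (hk : 0 < k) :
    approxSetFull (Function.update Φ j fun q => k * Φ j q) =ᵐ[volume] approxSetFull Φ := by
  rw [eventuallyEq_set]
  refine ae_of_ae_update ((measurableSet_approxSetFull _).iff (measurableSet_approxSetFull _)) j
    fun X => ?_
  filter_upwards [ae_infinite_approxPairsExcept_iff Φ hΦ j X hk] with y hy
  have h1 := approxPairs_update Φ j (Φ j) X y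
  rw [Function.update_eq_self] at h1
  simp only [approxSetFull, Set.mem_ofPred_eq]
  rw [h1, approxPairs_update]
  exact hy

/-- Up to null sets the set of infinitely often approximable points does not change when the
widths are multiplied by positive constants. -/
theorem approxSetFull_mul_ae_eq (Φ : Fin m → {q : Fin n → ℤ // q ≠ 0} → ℝ)
    (hΦ : ∀ j q, 0 ≤ Φ j q) (k : Fin m → ℝ) (hk : ∀ j, 0 < k j) :
    approxSetFull (fun j q => k j * Φ j q) =ᵐ[volume] approxSetFull Φ := by
  have main : ∀ s : Finset (Fin m),
      approxSetFull (fun j q => if j ∈ s then k j * Φ j q else Φ j q) =ᵐ[volume]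
        approxSetFull Φ := by
    intro s
    induction s using Finset.induction_on with
    | empty => simp only [Finset.notMem_empty, if_false]; exact EventuallyEq.rfl
    | insert a s ha ih =>
      refine EventuallyEq.trans ?_ ih
      have := approxSetFull_update_ae_eq (fun j q => if j ∈ s then k j * Φ j q else Φ j q)
        (fun j q => by split_ifs; exacts [mul_nonneg (hk j).le (hΦ j q), hΦ j q]) a (hk a)
      have heq : (fun j q => if j ∈ insert a s then k j * Φ j q else Φ j q) =
          Function.update (fun j q => if j ∈ s then k j * Φ j q else Φ j q) a
            fun q => k a * if a ∈ s then k a * Φ a q else Φ a q := by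
        funext j q
        by_cases hj : j = a
        · subst hj; simp [ha]
        · simp [hj]
      rw [heq]
      exact this
  simpa using main Finset.univ

end Scaling

/-! ### The zero-one law by divisibility of `q` -/

section Main

open Filter Topology Metric

variable {n m : ℕ}

/-- The inequalities are strict, so width 0 discards `q`. The column `j₀` guarantees that there is
an inequality to fail. -/
theorem mem_approxPairs_indicator (Φ : Fin m → {q : Fin n → ℤ // q ≠ 0} → ℝ)
    (S : Set {q : Fin n → ℤ // q ≠ 0}) (j₀ : Fin m) (X : Fin m → Fin n → ℝ)
    (qp : {q : Fin n → ℤ // q ≠ 0} × (Fin m → ℤ)) :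
    qp ∈ approxPairs (fun j => S.indicator (Φ j)) X ↔ qp ∈ approxPairs Φ X ∧ qp.1 ∈ S := by
  by_cases hS : qp.1 ∈ S
  · simp [approxPairs, hS]
  · simp only [approxPairs, Set.mem_ofPred_eq, Set.indicator_of_notMem hS, hS, and_false,
      iff_false, not_and, not_forall]
    exact fun _ => ⟨j₀, not_lt.2 (abs_nonneg _)⟩

/-- Modulo a common prime `r` of `q`, the new vector is `p` times a unit in the first case and `-u`
in the second. -/
theorem GloballyCoprime.mul_sub {q : Fin n → ℤ} {p : Fin m → ℤ} (h : GloballyCoprime q p)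
    {l : ℤ} {u : Fin m → ℤ}
    (hu : ∀ r : ℕ, r.Prime → (∀ i, (r : ℤ) ∣ q i) →
      (¬ (r : ℤ) ∣ l ∧ ∀ j, (r : ℤ) ∣ u j) ∨ ((r : ℤ) ∣ l ∧ ∃ j, ¬ (r : ℤ) ∣ u j)) :
    GloballyCoprime q (fun j => l * p j - u j) := by
  rw [globallyCoprime_iff] at h ⊢
  intro r hr hrq hrp
  rcases hu r hr hrq with ⟨hl, hj⟩ | ⟨hl, j, hj⟩
  · refine h r hr hrq fun j => ?_
    exact ((Nat.prime_iff_prime_int.1 hr).dvd_or_dvd ((dvd_sub_left (hj j)).1 (hrp j))).resolve_left hl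
  · exact hj ((dvd_sub_right (hl.mul_right _)).1 (hrp j))

/-- The effect of the affine map `X ↦ l • X + v` on the approximable points. -/
theorem smul_add_mem_approxSetFull (Φ : Fin m → {q : Fin n → ℤ // q ≠ 0} → ℝ)
    (S : Set {q : Fin n → ℤ // q ≠ 0}) (j₀ : Fin m) {l : ℕ} (hl : 0 < l) (v : Fin m → Fin n → ℝ)
    (u : {q : Fin n → ℤ // q ≠ 0} → Fin m → ℤ)
    (huv : ∀ q ∈ S, ∀ j, ∑ i, (q.1 i : ℝ) * v j i = u q j)
    (hu : ∀ q ∈ S, ∀ r : ℕ, r.Prime → (∀ i, (r : ℤ) ∣ q.1 i) →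
      (¬ (r : ℤ) ∣ (l : ℤ) ∧ ∀ j, (r : ℤ) ∣ u q j) ∨ ((r : ℤ) ∣ (l : ℤ) ∧ ∃ j, ¬ (r : ℤ) ∣ u q j))
    {X : Fin m → Fin n → ℝ} (hX : X ∈ approxSetFull (fun j => S.indicator (Φ j))) :
    (l : ℝ) • X + v ∈ approxSetFull (fun j q => (l : ℝ) * S.indicator (Φ j) q) := by
  have hl' : (0 : ℝ) < l := by exact_mod_cast hl
  set f : {q : Fin n → ℤ // q ≠ 0} × (Fin m → ℤ) → {q : Fin n → ℤ // q ≠ 0} × (Fin m → ℤ) :=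
    fun qp => (qp.1, fun j => l * qp.2 j - u qp.1 j) with hf
  have hinj : Function.Injective f := by
    rintro ⟨q, p⟩ ⟨q', p'⟩ h
    simp only [hf, Prod.mk.injEq] at h
    obtain ⟨rfl, h2⟩ := h
    refine Prod.ext rfl (funext fun j => ?_)
    have := congrFun h2 j
    simp only [sub_left_inj] at this
    exact mul_left_cancel₀ (by exact_mod_cast hl.ne') this
  refine (Set.Infinite.image hinj.injOn hX).mono ?_
  rintro _ ⟨⟨q, p⟩, hqp, rfl⟩
  have hqS := ((mem_approxPairs_indicator Φ S j₀ X _).1 hqp).2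
  refine ⟨hqp.1.mul_sub (hu q hqS), fun j => ?_⟩
  have h1 := hqp.2 j
  have h2 := huv q hqS j
  have h3 : (∑ i, (q.1 i : ℝ) * ((l : ℝ) • X + v) j i) + (((l * p j - u q j : ℤ)) : ℝ) =
      l * ((∑ i, (q.1 i : ℝ) * X j i) + p j) := by
    simp only [Pi.add_apply, Pi.smul_apply, smul_eq_mul, mul_add, Finset.sum_add_distrib, h2,
      Finset.mul_sum]
    push_cast
    have : ∀ i, (q.1 i : ℝ) * (l * X j i) = l * (q.1 i * X j i) := fun i => by ring
    simp only [this]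
    ring
  change |(∑ i, (q.1 i : ℝ) * ((l : ℝ) • X + v) j i) + (((l * p j - u q j : ℤ)) : ℝ)| < _
  rw [h3, abs_mul, abs_of_pos hl']
  exact mul_lt_mul_of_pos_left h1 hl'

/-- Invariance under translations that move every `q · X j` by an integer divisible by the common
prime factors of `q`. -/
theorem preimage_add_approxSetFull (Φ : Fin m → {q : Fin n → ℤ // q ≠ 0} → ℝ)
    (S : Set {q : Fin n → ℤ // q ≠ 0}) (j₀ : Fin m) (v : Fin m → Fin n → ℝ)
    (u : {q : Fin n → ℤ // q ≠ 0} → Fin m → ℤ)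
    (huv : ∀ q ∈ S, ∀ j, ∑ i, (q.1 i : ℝ) * v j i = u q j)
    (hu : ∀ q ∈ S, ∀ r : ℕ, r.Prime → (∀ i, (r : ℤ) ∣ q.1 i) → ∀ j, (r : ℤ) ∣ u q j) :
    (fun X => X + v) ⁻¹' approxSetFull (fun j => S.indicator (Φ j)) =
      approxSetFull (fun j => S.indicator (Φ j)) := by
  have hndvd : ∀ r : ℕ, r.Prime → ¬ (r : ℤ) ∣ ((1 : ℕ) : ℤ) := fun r hr h =>
    hr.one_lt.ne' (Nat.dvd_one.1 (Int.natCast_dvd_natCast.1 h))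
  ext X
  constructor
  · intro hX
    have := smul_add_mem_approxSetFull Φ S j₀ one_pos (-v) (fun q j => -u q j)
      (fun q hq j => by simp [huv q hq j])
      (fun q hq r hr hrq => .inl ⟨hndvd r hr, fun j => (hu q hq r hr hrq j).neg_right⟩) hX
    simpa using this
  · intro hX
    have := smul_add_mem_approxSetFull Φ S j₀ one_pos v u huv
      (fun q hq r hr hrq => .inl ⟨hndvd r hr, hu q hq r hr hrq⟩) hX
    simpa using this

theorem preimage_add_intCast_approxSetFull (Φ : Fin m → {q : Fin n → ℤ // q ≠ 0} → ℝ)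
    (S : Set {q : Fin n → ℤ // q ≠ 0}) (j₀ : Fin m) (z : Fin m → Fin n → ℤ) :
    (fun X => X + fun j i => (z j i : ℝ)) ⁻¹' approxSetFull (fun j => S.indicator (Φ j)) =
      approxSetFull (fun j => S.indicator (Φ j)) :=
  preimage_add_approxSetFull Φ S j₀ _ (fun q j => ∑ i, q.1 i * z j i)
    (fun q _ j => by push_cast; rfl)
    fun q _ r _ hrq j => Finset.dvd_sum fun i _ => (hrq i).mul_right _

theorem exists_dist_add_div_le {l : ℕ} (hl : 0 < l) (x y : Fin m → Fin n → ℝ) :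
    ∃ z : Fin m → Fin n → ℤ, dist (x + fun j i => (z j i : ℝ) / l) y ≤ 1 / l := by
  have hl' : (0 : ℝ) < l := by exact_mod_cast hl
  refine ⟨fun j i => round ((l : ℝ) * (y j i - x j i)), ?_⟩
  refine (dist_pi_le_iff (by positivity)).2 fun j => (dist_pi_le_iff (by positivity)).2 fun i => ?_
  have h1 := abs_sub_round ((l : ℝ) * (y j i - x j i))
  have h2 : x j i + (round ((l : ℝ) * (y j i - x j i)) : ℝ) / l - y j i =
      -(((l : ℝ) * (y j i - x j i)) - round ((l : ℝ) * (y j i - x j i))) / l := by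
    field_simp; ring
  rw [Real.dist_eq, Pi.add_apply, Pi.add_apply, h2, abs_div, abs_neg, abs_of_pos hl']
  gcongr
  linarith

theorem sum_mul_intCast_div {q z : Fin n → ℤ} {l : ℕ} (hl : 0 < l) (h : ∀ i, (l : ℤ) ∣ q i) :
    ∑ i, (q i : ℝ) * ((z i : ℝ) / l) = ((∑ i, q i / l * z i : ℤ) : ℝ) := by
  push_cast
  refine Finset.sum_congr rfl fun i _ => ?_
  have hl' : (l : ℝ) ≠ 0 := by exact_mod_cast hl.ne'
  rw [Int.cast_div (h i) (by exact_mod_cast hl')]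
  push_cast
  field_simp

theorem prime_dvd_div_of_ne {l r : ℕ} (hl : l.Prime) (hr : r.Prime) (hne : r ≠ l) {a : ℤ}
    (hla : (l : ℤ) ∣ a) (hra : (r : ℤ) ∣ a) : (r : ℤ) ∣ a / l := by
  obtain ⟨b, rfl⟩ := hla
  rw [Int.mul_ediv_cancel_left _ (by exact_mod_cast hl.ne_zero)]
  refine ((Nat.prime_iff_prime_int.1 hr).dvd_or_dvd hra).resolve_left fun h => hne ?_
  exact (Nat.prime_dvd_prime_iff_eq hr hl).1 (Int.natCast_dvd_natCast.1 h)

/-- Zero-one law for a subfamily that is stable under an affine expansion. -/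
theorem volume_approxSetFull_indicator (Φ : Fin m → {q : Fin n → ℤ // q ≠ 0} → ℝ)
    (hΦ : ∀ j q, 0 ≤ Φ j q)
    (S : Set {q : Fin n → ℤ // q ≠ 0}) (j₀ : Fin m) {l : ℕ} (hl : 1 < l) (v : Fin m → Fin n → ℝ)
    (u : {q : Fin n → ℤ // q ≠ 0} → Fin m → ℤ)
    (huv : ∀ q ∈ S, ∀ j, ∑ i, (q.1 i : ℝ) * v j i = u q j)
    (hu : ∀ q ∈ S, ∀ r : ℕ, r.Prime → (∀ i, (r : ℤ) ∣ q.1 i) →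
      (¬ (r : ℤ) ∣ (l : ℤ) ∧ ∀ j, (r : ℤ) ∣ u q j) ∨
        ((r : ℤ) ∣ (l : ℤ) ∧ ∃ j, ¬ (r : ℤ) ∣ u q j)) :
    volume (approxSetFull (fun j => S.indicator (Φ j))) = 0 ∨
      volume (approxSetFull (fun j => S.indicator (Φ j)))ᶜ = 0 := by
  have hl0 : (0 : ℝ) < l := by exact_mod_cast zero_lt_one.trans hl
  have : (volume : Measure (Fin m → Fin n → ℝ)).IsAddHaarMeasure :=
    Measure.pi.isAddHaarMeasure _
  refine measure_eq_zero_or_compl_of_homothety (measurableSet_approxSetFull _) (c := l)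
    (by exact_mod_cast hl) v ?_ one_pos fun x y => ?_
  -- The homothety multiplies the widths by `l`, which scaling undoes up to a null set;
  -- nonsingularity of the map lets that null set be pulled back.
  · have h1 := approxSetFull_mul_ae_eq (fun j => S.indicator (Φ j))
      (fun j q => Set.indicator_nonneg (fun q _ => hΦ j q) q) (fun _ => (l : ℝ)) fun _ => hl0
    have hq : Measure.QuasiMeasurePreserving (fun X : Fin m → Fin n → ℝ => (l : ℝ) • X + v)
        volume volume := by
      refine ⟨by fun_prop, Measure.AbsolutelyContinuous.mk fun A hA h0 => ?_⟩
      rw [Measure.map_apply (by fun_prop) hA, measure_preimage_smul_add hl0.ne', h0, mul_zero]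
    filter_upwards [hq.ae h1.mem_iff] with X hX hXE
    exact hX.1 (smul_add_mem_approxSetFull Φ S j₀ (by omega) v u huv hu hXE)
  · obtain ⟨z, hz⟩ := exists_dist_add_div_le one_pos x y
    simp only [Nat.cast_one, div_one] at hz
    exact ⟨_, hz, .of_eq (preimage_add_intCast_approxSetFull Φ S j₀ z)⟩

theorem approxSetFull_indicator_subset (Φ : Fin m → {q : Fin n → ℤ // q ≠ 0} → ℝ)
    (S : Set {q : Fin n → ℤ // q ≠ 0}) (j₀ : Fin m) :
    approxSetFull (fun j => S.indicator (Φ j)) ⊆ approxSetFull Φ := fun X hX =>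
  Set.Infinite.mono (fun qp h => ((mem_approxPairs_indicator Φ S j₀ X qp).1 h).1) hX

/-- Zero-one law for the set of infinitely often approximable points. -/
theorem volume_approxSetFull (Φ : Fin m → {q : Fin n → ℤ // q ≠ 0} → ℝ)
    (hΦ : ∀ j q, 0 ≤ Φ j q) (j₀ : Fin m) :
    volume (approxSetFull Φ) = 0 ∨ volume (approxSetFull Φ)ᶜ = 0 := by
  have : (volume : Measure (Fin m → Fin n → ℝ)).IsAddHaarMeasure :=
    Measure.pi.isAddHaarMeasure _
  rw [or_iff_not_imp_right]
  intro hfull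
  set E : Set {q : Fin n → ℤ // q ≠ 0} → Set (Fin m → Fin n → ℝ) :=
    fun S => approxSetFull (fun j => S.indicator (Φ j)) with hE
  -- A conull subfamily would make the whole set conull.
  have hnull : ∀ S, volume (E S) = 0 ∨ volume (E S)ᶜ = 0 → volume (E S) = 0 := fun S h =>
    h.resolve_right fun h0 => hfull (measure_mono_null
      (Set.compl_subset_compl.2 (approxSetFull_indicator_subset Φ S j₀)) h0)
  have hnull₁ : ∀ l : ℕ, l.Prime → volume (E {q | ¬ ∀ i, (l : ℤ) ∣ q.1 i}) = 0 := by
    intro l hl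
    refine hnull _ (volume_approxSetFull_indicator Φ hΦ _ j₀ hl.one_lt 0 (fun _ _ => 0)
      (by simp) fun q hq r hr hrq => .inl ⟨fun h => hq ?_, fun _ => dvd_zero _⟩)
    rwa [← (Nat.prime_dvd_prime_iff_eq hr hl).1 (Int.natCast_dvd_natCast.1 h)]
  have hnull₂ : ∀ l : ℕ, l.Prime → ∀ i₀,
      volume (E {q | (∀ i, (l : ℤ) ∣ q.1 i) ∧ ¬ (l : ℤ) ∣ q.1 i₀ / l}) = 0 := by
    intro l hl i₀
    -- Translating this one coordinate by `1 / l` shifts `p j₀` by `q i₀ / l`, which is prime to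
    -- `l`; this restores the coprimality at `l` that multiplying `p` by `l` would destroy.
    set z : Fin m → Fin n → ℤ := fun j i => if j = j₀ ∧ i = i₀ then 1 else 0 with hz
    refine hnull _ (volume_approxSetFull_indicator Φ hΦ _ j₀ hl.one_lt
      (fun j i => (z j i : ℝ) / l) (fun q j => ∑ i, q.1 i / l * z j i)
      (fun q hq j => sum_mul_intCast_div hl.pos hq.1) fun q hq r hr hrq => ?_)
    by_cases hrl : r = l
    · subst hrl
      refine .inr ⟨dvd_rfl, j₀, ?_⟩
      simpa [hz] using hq.2
    · refine .inl ⟨fun h => hrl ?_, fun j => Finset.dvd_sum fun i _ =>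
        (prime_dvd_div_of_ne hl hr hrl (hq.1 i) (hrq i)).mul_right _⟩
      exact (Nat.prime_dvd_prime_iff_eq hr hl).1 (Int.natCast_dvd_natCast.1 h)
  have hae : ∀ l : ℕ, l.Prime →
      E {q | (∀ i, (l : ℤ) ∣ q.1 i) ∧ ∀ i, (l : ℤ) ∣ q.1 i / l} =ᵐ[volume] approxSetFull Φ := by
    intro l hl
    refine EventuallyLE.antisymm
      (LE.le.eventuallyLE (approxSetFull_indicator_subset Φ _ j₀)) ?_
    have h1 := measure_eq_zero_iff_ae_notMem.1 (hnull₁ l hl)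
    have h2 := ae_all_iff.2 fun i₀ => measure_eq_zero_iff_ae_notMem.1 (hnull₂ l hl i₀)
    filter_upwards [h1, h2] with X hX1 hX2 hX
    by_contra hX3
    have hfin := ((Set.not_infinite.1 hX1).union (Set.finite_iUnion fun i₀ =>
      Set.not_infinite.1 (hX2 i₀))).union (Set.not_infinite.1 hX3)
    refine hX (hfin.subset fun qp hqp => ?_)
    simp only [Set.mem_union, Set.mem_iUnion, mem_approxPairs_indicator _ _ j₀, hqp, true_and,
      Set.mem_ofPred_eq]
    by_cases c1 : ∀ i, (l : ℤ) ∣ qp.1.1 i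
    · by_cases c2 : ∀ i, (l : ℤ) ∣ qp.1.1 i / l
      · exact .inr ⟨c1, c2⟩
      · push Not at c2
        obtain ⟨i₀, hi₀⟩ := c2
        exact .inl (.inr ⟨i₀, c1, hi₀⟩)
    · exact .inl (.inl c1)
  refine (measure_eq_zero_or_compl_of_fine_translations (measurableSet_approxSetFull Φ)
    fun ε hε => ?_).resolve_right hfull
  obtain ⟨N, hN⟩ := exists_nat_gt (1 / ε)
  obtain ⟨l, hlN, hl⟩ := Nat.exists_infinite_primes N
  have hl0 : (0 : ℝ) < l := by exact_mod_cast hl.pos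
  refine ⟨1 / l, by positivity, ?_, fun x y => ?_⟩
  · rw [div_lt_comm₀ hl0 hε]
    exact hN.trans_le (by exact_mod_cast hlN)
  · obtain ⟨z, hz⟩ := exists_dist_add_div_le hl.pos x y
    refine ⟨_, hz, ?_⟩
    -- Since `l² ∣ q`, the shifts `q · z / l` remain divisible by every common prime of `q`,
    -- including `l`.
    have h1 := preimage_add_approxSetFull Φ
      {q | (∀ i, (l : ℤ) ∣ q.1 i) ∧ ∀ i, (l : ℤ) ∣ q.1 i / l} j₀
      (fun j i => (z j i : ℝ) / l) (fun q j => ∑ i, q.1 i / l * z j i)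
      (fun q hq j => sum_mul_intCast_div hl.pos hq.1) fun q hq r hr hrq j =>
        Finset.dvd_sum fun i _ => Dvd.dvd.mul_right (by
          by_cases hrl : r = l
          · subst hrl; exact hq.2 i
          · exact prime_dvd_div_of_ne hl hr hrl (hq.1 i) (hrq i)) _
    have h2 := (measurePreserving_add_right volume
      (fun (j : Fin m) (i : Fin n) => (z j i : ℝ) / l)).quasiMeasurePreserving.preimage_ae_eq
        (hae l hl)
    exact h2.symm.trans ((EventuallyEq.of_eq h1).trans (hae l hl))

theorem volume_setOf_forall_mem_Icc :
    volume {X : Fin m → Fin n → ℝ | ∀ j i, X j i ∈ Set.Icc (0 : ℝ) 1} = 1 := by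
  have : {X : Fin m → Fin n → ℝ | ∀ j i, X j i ∈ Set.Icc (0 : ℝ) 1} =
      Set.univ.pi fun _ => Set.univ.pi fun _ => Set.Icc (0 : ℝ) 1 := by
    ext X; simp only [Set.mem_pi, Set.mem_univ, true_imp_iff, Set.mem_ofPred_eq]
  rw [this, volume_pi_pi, volume_pi_pi]
  simp

theorem approxSetC_eq_inter (Φ : Fin m → {q : Fin n → ℤ // q ≠ 0} → ℝ) :
    approxSetC Φ = {X | ∀ j i, X j i ∈ Set.Icc (0 : ℝ) 1} ∩ approxSetFull Φ := rfl

theorem volume_approxSetC_of_pos (Φ : Fin m → {q : Fin n → ℤ // q ≠ 0} → ℝ)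
    (hΦ : ∀ j q, 0 ≤ Φ j q) (j₀ : Fin m) :
    volume (approxSetC Φ) = 0 ∨ volume (approxSetC Φ) = 1 := by
  rw [approxSetC_eq_inter]
  refine (volume_approxSetFull Φ hΦ j₀).imp
    (fun h => measure_mono_null Set.inter_subset_right h) fun h => ?_
  rw [measure_inter_conull h, volume_setOf_forall_mem_Icc]

end Main

theorem theorem3p3 (n m : ℕ)
    (Ψ : Fin m → {q : Fin n → ℤ // q ≠ 0} → ℝ) (hΨ : ∀ j q, 0 ≤ Ψ j q) :
    ∃ c : ℝ≥0∞, (c = 0 ∨ c = 1) ∧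
      ∀ k : Fin m → ℝ, (∀ j, 0 < k j) →
        volume (approxSetC (fun j q => k j * Ψ j q)) = c := by
  refine ⟨volume (approxSetC Ψ), ?_, fun k hk => ?_⟩
  -- For `m = 0` there is no column `j₀`, but the space is a single point of mass 1.
  · rcases Nat.eq_zero_or_pos m with rfl | hm
    · rcases (approxSetC Ψ).eq_empty_or_nonempty with h | h
      · exact .inl (by rw [h, measure_empty])
      · right
        rw [Subsingleton.eq_univ_of_nonempty h, ← volume_setOf_forall_mem_Icc (n := n) (m := 0)]
        congr 1
        ext X
        simp
    · exact volume_approxSetC_of_pos Ψ hΨ ⟨0, hm⟩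
  · rw [approxSetC_eq_inter, approxSetC_eq_inter]
    exact measure_congr ((Filter.EventuallyEq.refl _ _).inter
      (approxSetFull_mul_ae_eq Ψ hΨ k hk))
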